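/- All C*-algebras are complex, possibly non-unital; morphisms are $*$-homomorphisms (not necessarily unital). For a C*-algebra $F$ and $k\ge 1$ let $S^{k-1}=\partial[0,1]^k$, and let $\partial\colon C([0,1]^k\to F)\to C(S^{k-1}\to F)$ be the restriction morphism. An *NCCW complex of dimension $n$* is a sequence of C*-algebras $A_0,\dots,A_n$ together with finite-dimensional C*-algebras $F_0,\dots,F_n$, with $A_0= F_0$ and $F_n\neq 0$ if $n\ge 1$, and with morphisms (arbitrary "connecting morphisms") $\sigma_k\colon A_{k-1}\to C(S^{k-1}\to F_k)$, $1\le k\le n$, such that $$A_k = \{\,f\oplus a\in C([0,1]^k\to F_k)\oplus A_{k-1} : \partial f=\sigma_k(a)\,\}\qquad(1\le k\le n).$$ Let $\rho_k\colon A_k\to C([0,1]^k\to F_k)$ and $\pi\colon A_k\to A_{k-1}$ be the two projections (for $k=0$, $[0,1]^0$ is a point and $\rho_0$ is the identification $A_0=F_0=C([0,1]^0\to F_0)$). A C*-algebra is called an NCCW complex of dimension $n$ if it is isomorphic to the algebra $A_n$ of such a sequence. The *canonical ideals* $A_n=I_0\supseteq I_1\supseteq\dots\supseteq I_n$ are $I_k=\ker(A_n\to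 A_{k-1})$ for $1\le k\le n$, and $I_k=0$ for $k>n$; via $\rho_k$, $I_k/I_{k+1}= C_0((0,1)^k\to F_k)$ for $0\le k\le n$. Let $A_n$ and $B_m$ be NCCW complexes of dimensions $n$ and $m$ with cell algebras $F_k$, $G_k$ and canonical ideals $I_k$, $J_k$. A morphism $\alpha\colon A_n\to B_m$ is *simplicial* if 1. $\alpha(I_k)\subseteq J_k$ for all $k$ (in particular $\alpha(I_k)=0$ for $k>m$); and 2. for each $k\le\min(n,m)$ there are a morphism $\varphi_k\colon F_k\to G_k$ and a homeomorphism $i_k$ of $[0,1]^k$ such that the morphism $C_0((0,1)^k\to F_k)\to C_0((0,1)^k\to G_k)$ induced by $\alpha$ on $I_k/I_{k+1}\to J_k/J_{k+1}$ is $g\mapsto \varphi_k\circ g\circ i_k$, i.e. $i_k^*\otimes\varphi_k$. **Proposition.** Let $\alpha\colon A_n\to B_m$ be a simplicial morphism between NCCW complexes of dimensions $n$ and $m$, where $B_m\neq 0$ in case $n=0$. Then the NC mapping cylinder $$\mathrm{Cyl}(\alpha)=\{\,a\oplus f\in A_n\oplus C([0,1]\to B_m) : f(1)=\alpha(a)\,\}$$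 is an NCCW complex of dimension $\max\{n,m+1\}$. -/

import Mathlib

universe u

noncomputable section

/-- The closed cube `[0,1]^k`. For `k = 0` it is a single point. -/
abbrev NCube (k : ℕ) : Type := Fin k → unitInterval

/-- The sphere `S^{k-1}`, realised as the boundary of the cube `[0,1]^k`: the points with some
coordinate equal to `0` or `1`. -/
abbrev NSphere (k : ℕ) : Type := ↥(Cube.boundary (Fin k))

/-- The boundary morphism `C([0,1]^k → F) → C(S^{k-1} → F)`: restriction to the boundary. -/
def boundaryMap (k : ℕ) (F : Type*) [NonUnitalCStarAlgebra F] :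
    C(NCube k, F) →⋆ₙₐ[ℂ] C(NSphere k, F) where
  toFun f := f.restrict (Cube.boundary (Fin k))
  map_smul' _ _ := rfl
  map_zero' := rfl
  map_add' _ _ := rfl
  map_mul' _ _ := rfl
  map_star' _ := rfl

/-- `F → C(X → F)`, sending an element to the constant function. -/
def constMap (X : Type*) [TopologicalSpace X] (F : Type*) [NonUnitalCStarAlgebra F] :
    F →⋆ₙₐ[ℂ] C(X, F) where
  toFun c := ContinuousMap.const X c
  map_smul' _ _ := rfl
  map_zero' := rfl
  map_add' _ _ := rfl
  map_mul' _ _ := rfl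
  map_star' _ := rfl

section Constructions

variable {A B C : Type*} [NonUnitalNonAssocSemiring A] [Module ℂ A] [Star A]
  [NonUnitalNonAssocSemiring B] [Module ℂ B] [Star B]
  [NonUnitalNonAssocSemiring C] [Module ℂ C] [Star C]

/-- The pullback `A ⊕_C B = {a ⊕ b | f a = g b}` of two morphisms `f : A → C`, `g : B → C`. -/
def StarPullback (f : A →⋆ₙₐ[ℂ] C) (g : B →⋆ₙₐ[ℂ] C) :
    NonUnitalStarSubalgebra ℂ (A × B) where
  carrier := {p | f p.1 = g p.2}
  add_mem' := by intro p q hp hq; simp_all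
  zero_mem' := by simp
  mul_mem' := by intro p q hp hq; simp_all
  smul_mem' := by intro c p hp; simp_all
  star_mem' := by intro p hp; simp_all [map_star]

end Constructions

/-- An NCCW complex of dimension `n`: a sequence of C⋆-algebras `A 0, …, A n` and
finite-dimensional C⋆-algebras `F 0, …, F n` such that `A 0 = F 0` and, for `k < n`, `A (k+1)` is
(isomorphic to) the pullback of the restriction `C([0,1]^{k+1} → F (k+1)) → C(S^k → F (k+1))` and
an arbitrary connecting morphism `σ : A k → C(S^k → F (k+1))`. Members of the families `A`, `F`
with index above `n` play no role.
For `n ≥ 1` the top cell algebra `F n` is nonzero, so that `n` is the dimension;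
for `n = 0` any finite-dimensional C⋆-algebra is allowed. -/
structure NCCWComplex (n : ℕ) where
  /-- the `k`-skeleton algebras -/
  A : ℕ → Type u
  /-- the cell algebras -/
  F : ℕ → Type u
  [cstarA : ∀ k, NonUnitalCStarAlgebra (A k)]
  [cstarF : ∀ k, NonUnitalCStarAlgebra (F k)]
  [finF : ∀ k, FiniteDimensional ℂ (F k)]
  /-- the algebra in dimension zero is finite-dimensional -/
  iso₀ : A 0 ≃⋆ₐ[ℂ] F 0
  /-- the connecting morphisms -/
  σ : ∀ k, k < n → (A k →⋆ₙₐ[ℂ] C(NSphere (k + 1), F (k + 1)))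
  /-- the pullback decompositions -/
  iso : ∀ k (hk : k < n), A (k + 1) ≃⋆ₐ[ℂ] StarPullback (boundaryMap (k + 1) (F (k + 1))) (σ k hk)
  top_nontrivial : 1 ≤ n → Nontrivial (F n)

namespace NCCWComplex

attribute [instance] NCCWComplex.cstarA NCCWComplex.cstarF NCCWComplex.finF

variable {n : ℕ} (X : NCCWComplex.{u} n)

/-- The C⋆-algebra `A_n` underlying an `n`-dimensional NCCW complex. -/
abbrev total : Type u := X.A n

/-- The projection `π : A_{k+1} → A_k` onto the second factor of the pullback. -/
def π (k : ℕ) (hk : k < n) : X.A (k + 1) →⋆ₙₐ[ℂ] X.A k :=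
  ((NonUnitalStarAlgHom.snd ℂ C(NCube (k + 1), X.F (k + 1)) (X.A k)).comp
    (NonUnitalStarSubalgebraClass.subtype
      (StarPullback (boundaryMap (k + 1) (X.F (k + 1))) (X.σ k hk)))).comp
    (X.iso k hk : X.A (k + 1) →⋆ₙₐ[ℂ] _)

/-- The projection `ρ_k : A_k → C([0,1]^k → F_k)` onto the first factor of the pullback
for `k ≥ 1`; for `k = 0` it is the identification of `A_0 = F_0` with the functions on a point. -/
def ρ : ∀ k : ℕ, k ≤ n → (X.A k →⋆ₙₐ[ℂ] C(NCube k, X.F k))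
  | 0, _ => (constMap (NCube 0) (X.F 0)).comp (X.iso₀ : X.A 0 →⋆ₙₐ[ℂ] X.F 0)
  | k + 1, hk =>
    ((NonUnitalStarAlgHom.fst ℂ C(NCube (k + 1), X.F (k + 1)) (X.A k)).comp
      (NonUnitalStarSubalgebraClass.subtype
        (StarPullback (boundaryMap (k + 1) (X.F (k + 1))) (X.σ k hk)))).comp
      (X.iso k hk : X.A (k + 1) →⋆ₙₐ[ℂ] _)

/-- The composite `A_n → A_{n-1} → ⋯ → A_k` of the projections `π`. -/
def toSkeleton (k : ℕ) (hk : k ≤ n) : X.total →⋆ₙₐ[ℂ] X.A k :=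
  Nat.decreasingInduction (motive := fun j _ => X.total →⋆ₙₐ[ℂ] X.A j)
    (fun j hj f => (X.π j hj).comp f) (NonUnitalStarAlgHom.id ℂ X.total) hk

/-- The canonical ideals `A_n = I_0 ⊇ I_1 ⊇ ⋯ ⊇ I_n ⊇ 0 = I_{n+1} = ⋯`:
`I_{k+1}` is the kernel of `A_n → A_k`, so that `A_n / I_{k+1} = A_k`. -/
def ideal : ℕ → TwoSidedIdeal X.total
  | 0 => ⊤
  | k + 1 => if hk : k ≤ n then TwoSidedIdeal.ker (X.toSkeleton k hk) else ⊥

/-- The composite `A_n → A_k → C([0,1]^k → F_k)`. Restricted to `I_k` it has kernel `I_{k+1}` and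
its image consists of the functions vanishing on the boundary of the cube; it is the identification
`I_k / I_{k+1} = C₀((0,1)^k → F_k)`. -/
def cellMap (k : ℕ) (hk : k ≤ n) : X.total →⋆ₙₐ[ℂ] C(NCube k, X.F k) :=
  (X.ρ k hk).comp (X.toSkeleton k hk)

end NCCWComplex

/-- Simplicial morphisms between NCCW complexes. Under the identifications
`I_k / I_{k+1} = C₀((0,1)^k → F_k)` and `J_k / J_{k+1} = C₀((0,1)^k → G_k)`, the map induced
by `α` is `i^* ⊗ φ`, that is `g ↦ φ ∘ g ∘ i`. There is nothing to require in the second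
condition for `m < k ≤ n`, as then `J_k = 0`. -/
structure IsSimplicial {n m : ℕ} (X : NCCWComplex.{u} n) (Y : NCCWComplex.{u} m)
    (α : X.total →⋆ₙₐ[ℂ] Y.total) : Prop where
  map_ideal : ∀ k, ∀ a ∈ X.ideal k, α a ∈ Y.ideal k
  map_cell : ∀ k (hn : k ≤ n) (hm : k ≤ m),
    ∃ (φ : X.F k →⋆ₙₐ[ℂ] Y.F k) (i : NCube k ≃ₜ NCube k),
      ∀ a ∈ X.ideal k, ∀ x : NCube k, Y.cellMap k hm (α a) x = φ (X.cellMap k hn a (i x))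

/-- The C⋆-algebra `C` is (isomorphic to) an NCCW complex of dimension `n`. -/
def IsNCCWOfDim (n : ℕ) (C : Type u) [NonUnitalCStarAlgebra C] : Prop :=
  ∃ X : NCCWComplex.{u} n, Nonempty (C ≃⋆ₐ[ℂ] X.total)

section Cylinder

variable {A B : Type u} [NonUnitalCStarAlgebra A] [NonUnitalCStarAlgebra B]

/-- The NC mapping cylinder `{a ⊕ f ∈ A ⊕ C([0,1] → B) | f 1 = α a}`. -/
def Cyl (α : A →⋆ₙₐ[ℂ] B) : NonUnitalStarSubalgebra ℂ (A × C(unitInterval, B)) where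
  carrier := {p | p.2 1 = α p.1}
  add_mem' := by intro p q hp hq; simp_all
  zero_mem' := by simp
  mul_mem' := by intro p q hp hq; simp_all
  smul_mem' := by intro c p hp; simp_all
  star_mem' := by intro p hp; simp_all [map_star]

theorem Cyl.isClosed (α : A →⋆ₙₐ[ℂ] B) : IsClosed (Cyl α : Set (A × C(unitInterval, B))) := by
  have h1 : Continuous fun p : A × C(unitInterval, B) => p.2 1 :=
    (continuous_eval_const (F := C(unitInterval, B)) (1 : unitInterval)).comp continuous_snd
  have h2 : Continuous fun p : A × C(unitInterval, B) => α p.1 :=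
    (AddMonoidHomClass.continuous_of_bound α 1
      (by simpa only [one_mul] using NonUnitalStarAlgHom.norm_apply_le α)).comp continuous_fst
  exact isClosed_eq h1 h2

instance Cyl.nonUnitalCStarAlgebra (α : A →⋆ₙₐ[ℂ] B) : NonUnitalCStarAlgebra (Cyl α) :=
  NonUnitalStarSubalgebra.nonUnitalCStarAlgebra (Cyl α) (h_closed := Cyl.isClosed α)

end Cylinder

end

/-! ### Morphisms of function algebras and restriction to the boundary of a cube -/

noncomputable section

/-! The cylinder has three kinds of cells: those of A_n at the end t = 1, those of B_m at the end t
= 0, and, for each k-cell of B_m, its product with the interval, of dimension k + 1. As α respects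
the canonical ideals, it descends to compatible morphisms α_k : A_k → B_k. The k-skeleton is then
the algebra of triples a ⊕ f ⊕ b in A_k ⊕ C([0,1] → B_{k-1}) ⊕ B_k with f(1) = α_{k-1}(π a) and f(0)
= π b, and the k-cells have algebra F_k ⊕ G_k ⊕ G_{k-1}.

On product cells, the connecting morphism takes values on the boundary of [0,1] × [0,1]^k: it is
ρ(α_k a) on the face t = 1, ρ(b) on t = 0 and σ(f(t)) on the side wall. The conditions on the triple
make these agree where they meet (`glueFun_boundary`, `continuousOn_glueFun`). The next skeleton is
the resulting pullback because a path in B_{k-1} with a compatible function on the cylinder over the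
k-cells is the same as a path in B_k (`exists_path_lift`).

To treat all n and m alike, complexes become infinite towers (`CellTower`), with the zero algebra as
(-1)-skeleton and no cells above the dimension. At N = max(n, m + 1) both towers have stabilised, b
is determined by f(0), and the N-skeleton is the cylinder (`cylToSkel_bijective`). -/

theorem starHom_continuous {A B : Type*} [NonUnitalCStarAlgebra A] [NonUnitalCStarAlgebra B]
    (φ : A →⋆ₙₐ[ℂ] B) : Continuous φ :=
  AddMonoidHomClass.continuous_of_bound φ 1
    (by simpa only [one_mul] using NonUnitalStarAlgHom.norm_apply_le φ)

/-- Post-composition with a morphism, as a morphism of function algebras. -/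
def mapHom (X : Type*) [TopologicalSpace X] {A B : Type*} [NonUnitalCStarAlgebra A]
    [NonUnitalCStarAlgebra B] (φ : A →⋆ₙₐ[ℂ] B) : C(X, A) →⋆ₙₐ[ℂ] C(X, B) where
  toFun f := ⟨fun x => φ (f x), (starHom_continuous φ).comp f.continuous⟩
  map_smul' _ _ := by ext; simp
  map_zero' := by ext; simp
  map_add' _ _ := by ext; simp
  map_mul' _ _ := by ext; simp
  map_star' _ := by ext; simp [map_star]

@[simp] theorem mapHom_apply {X : Type*} [TopologicalSpace X] {A B : Type*}
    [NonUnitalCStarAlgebra A] [NonUnitalCStarAlgebra B] (φ : A →⋆ₙₐ[ℂ] B) (f : C(X, A)) (x : X) :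
    mapHom X φ f x = φ (f x) := rfl

@[simp] theorem boundaryMap_apply (k : ℕ) (F : Type*) [NonUnitalCStarAlgebra F]
    (f : C(NCube k, F)) (x : NSphere k) : boundaryMap k F f x = f x := rfl

instance : IsEmpty (NSphere 0) := ⟨fun x => by obtain ⟨i, _⟩ := x.2; exact i.elim0⟩

theorem Cube.isClosed_boundary (k : ℕ) : IsClosed (Cube.boundary (Fin k)) := by
  have : Cube.boundary (Fin k) = ⋃ i : Fin k, {y | y i = 0 ∨ y i = 1} := by
    ext y; simp [Cube.boundary]
  rw [this]
  refine isClosed_iUnion_of_finite fun i => ?_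
  exact (isClosed_eq (continuous_apply i) continuous_const).union
    (isClosed_eq (continuous_apply i) continuous_const)

instance (k : ℕ) : CompactSpace (NSphere k) :=
  isCompact_iff_compactSpace.mp (Cube.isClosed_boundary k).isCompact

/-- Tietze extension, available because F is a finite-dimensional vector space. -/
theorem boundaryMap_surjective (k : ℕ) (F : Type*) [NonUnitalCStarAlgebra F]
    [FiniteDimensional ℂ F] : Function.Surjective (boundaryMap k F) := by
  intro f
  have : TietzeExtension.{0} F := TietzeExtension.of_tvs ℂ
  obtain ⟨g, hg⟩ := f.exists_restrict_eq (Cube.isClosed_boundary k)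
  exact ⟨g, hg⟩

instance PUnit.nonUnitalCStarAlgebra : NonUnitalCStarAlgebra PUnit.{u + 1} where
  star _ := PUnit.unit
  star_involutive _ := rfl
  star_mul _ _ := rfl
  star_add _ _ := rfl
  star_smul _ _ := rfl
  norm_mul_self_le _ := by simp
  dist_eq _ _ := by simp
  norm_mul_le _ _ := by simp [norm_eq_zero]
  smul_zero _ := rfl
  smul_add _ _ _ := rfl
  add_smul _ _ _ := rfl
  zero_smul _ := rfl
  norm_smul_le _ _ := by simp

/-! ### Towers of skeleta -/

/-- A sequence of C⋆-algebras in which `A (k + 1)` arises from `A k` by attaching `k`-dimensional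
cells with cell algebra `F (k + 1)`, starting from the zero algebra `A 0`. -/
structure CellTower where
  /-- the skeleton algebras -/
  A : ℕ → Type u
  /-- the cell algebras -/
  F : ℕ → Type u
  [cstarA : ∀ k, NonUnitalCStarAlgebra (A k)]
  [cstarF : ∀ k, NonUnitalCStarAlgebra (F k)]
  [finF : ∀ k, FiniteDimensional ℂ (F k)]
  [subA : Subsingleton (A 0)]
  [subF : Subsingleton (F 0)]
  /-- the connecting morphisms -/
  σ : ∀ k, A k →⋆ₙₐ[ℂ] C(NSphere k, F (k + 1))
  /-- the projections onto the functions on cubes -/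
  ρ : ∀ k, A (k + 1) →⋆ₙₐ[ℂ] C(NCube k, F (k + 1))
  /-- the projections onto the lower skeleton -/
  π : ∀ k, A (k + 1) →⋆ₙₐ[ℂ] A k
  boundary_ρ : ∀ k a, boundaryMap k (F (k + 1)) (ρ k a) = σ k (π k a)
  ext : ∀ k a b, ρ k a = ρ k b → π k a = π k b → a = b
  exists_of_boundary : ∀ k f a, boundaryMap k (F (k + 1)) f = σ k a → ∃ b, ρ k b = f ∧ π k b = a

attribute [instance] CellTower.cstarA CellTower.cstarF CellTower.finF CellTower.subA
  CellTower.subF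

namespace CellTower

theorem π_surjective (T : CellTower.{u}) (k : ℕ) : Function.Surjective (T.π k) := fun a => by
  obtain ⟨f, hf⟩ := boundaryMap_surjective k (T.F (k + 1)) (T.σ k a)
  obtain ⟨b, -, hb⟩ := T.exists_of_boundary k f a hf
  exact ⟨b, hb⟩

end CellTower

/-! ### Composite projections between skeleta -/

namespace NCCWComplex

variable {n : ℕ} (X : NCCWComplex.{u} n)

theorem boundary_ρ (k : ℕ) (hk : k < n) (a : X.A (k + 1)) :
    boundaryMap (k + 1) (X.F (k + 1)) (X.ρ (k + 1) hk a) = X.σ k hk (X.π k hk a) :=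
  (X.iso k hk a).2

theorem ext_ρ_π (k : ℕ) (hk : k < n) (a b : X.A (k + 1))
    (h1 : X.ρ (k + 1) hk a = X.ρ (k + 1) hk b) (h2 : X.π k hk a = X.π k hk b) : a = b :=
  (X.iso k hk).injective (Subtype.ext (Prod.ext h1 h2))

theorem exists_of_boundary (k : ℕ) (hk : k < n) (f : C(NCube (k + 1), X.F (k + 1))) (a : X.A k)
    (h : boundaryMap (k + 1) (X.F (k + 1)) f = X.σ k hk a) :
    ∃ b, X.ρ (k + 1) hk b = f ∧ X.π k hk b = a := by
  obtain ⟨b, hb⟩ := (X.iso k hk).surjective ⟨(f, a), h⟩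
  exact ⟨b, congrArg (fun p => p.1.1) hb, congrArg (fun p => p.1.2) hb⟩

/-- The composite `A_i → A_{i-1} → ⋯ → A_j` of the projections `π`. -/
def trans (i j : ℕ) (hji : j ≤ i) (hi : i ≤ n) : X.A i →⋆ₙₐ[ℂ] X.A j :=
  Nat.decreasingInduction (motive := fun j _ => X.A i →⋆ₙₐ[ℂ] X.A j)
    (fun j hj f => (X.π j (hj.trans_le hi)).comp f) (NonUnitalStarAlgHom.id ℂ (X.A i)) hji

theorem trans_self (i : ℕ) (hi : i ≤ n) : X.trans i i le_rfl hi = NonUnitalStarAlgHom.id ℂ _ :=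
  Nat.decreasingInduction_self _ _

theorem trans_succ_left (i j : ℕ) (hji : j + 1 ≤ i) (hi : i ≤ n) :
    X.trans i j (Nat.le_of_succ_le hji) hi =
      (X.π j (lt_of_lt_of_le hji hi)).comp (X.trans i (j + 1) hji hi) :=
  Nat.decreasingInduction_succ_left _ _ hji _

theorem trans_eq_toSkeleton (k : ℕ) (hk : k ≤ n) : X.trans n k hk le_rfl = X.toSkeleton k hk :=
  rfl

theorem trans_trans (i j l : ℕ) (hji : j ≤ i) (hi : i ≤ n) (hlj : l ≤ j) (a : X.A i) :
    X.trans j l hlj (hji.trans hi) (X.trans i j hji hi a) = X.trans i l (hlj.trans hji) hi a := by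
  induction hlj using Nat.decreasingInduction with
  | self => rw [trans_self]; rfl
  | of_succ l hl ih =>
    rw [trans_succ_left _ _ _ hl, trans_succ_left _ _ _ (le_trans hl hji)]
    exact congrArg (X.π l (lt_of_lt_of_le hl (hji.trans hi))) ih

theorem trans_succ (k : ℕ) (hk : k < n) (a : X.A (k + 1)) :
    X.trans (k + 1) k k.le_succ hk a = X.π k hk a := by
  rw [trans_succ_left _ _ _ le_rfl, trans_self]; rfl

/-- Stated for a propositional equality of indices, so that truncated indices such as `min k n` need
no casts. -/
theorem trans_bijective {i j : ℕ} (h : i = j) (hi : i ≤ n) :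
    Function.Bijective (X.trans i j h.ge hi) := by
  subst h; rw [trans_self]; exact Function.bijective_id

end NCCWComplex

/-! ### The tower of an NCCW complex -/

namespace NCCWComplex

variable {n : ℕ} (X : NCCWComplex.{u} n)

/-- The cell algebra `F k` for `k ≤ n`, and the zero algebra for `k > n`. -/
def cellSub (k : ℕ) : NonUnitalStarSubalgebra ℂ (X.F k) where
  -- The algebras `F k` with k > n are arbitrary data. Cutting them down to zero by a subalgebra
  -- avoids a case distinction between types.
  carrier := {x | k ≤ n ∨ x = 0}
  add_mem' := by rintro a b (h | rfl) (h | rfl) <;> simp_all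
  zero_mem' := by simp
  mul_mem' := by rintro a b (h | rfl) (h | rfl) <;> simp_all
  smul_mem' := by rintro c a (h | rfl) <;> simp_all
  star_mem' := by rintro a (h | rfl) <;> simp_all

instance (k : ℕ) : NonUnitalCStarAlgebra (X.cellSub k) :=
  NonUnitalStarSubalgebra.nonUnitalCStarAlgebra (X.cellSub k) (h_closed := by
    by_cases h : k ≤ n
    · convert isClosed_univ
      ext x; exact iff_of_true (Or.inl h) trivial
    · convert isClosed_singleton (x := (0 : X.F k))
      ext x; exact or_iff_right h)

instance (k : ℕ) : FiniteDimensional ℂ (X.cellSub k) :=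
  FiniteDimensional.of_injective
    ((NonUnitalStarSubalgebraClass.subtype (X.cellSub k) : X.cellSub k →ₗ[ℂ] X.F k))
    Subtype.val_injective

theorem cellSub_subsingleton (k : ℕ) (hk : n < k) : Subsingleton (X.cellSub k) :=
  ⟨fun a b => Subtype.ext ((a.2.resolve_left hk.not_ge).trans (b.2.resolve_left hk.not_ge).symm)⟩

/-- The skeleton algebras, shifted by one and continued constantly above `n`. -/
def towerA : ℕ → Type u
  | 0 => PUnit
  | k + 1 => X.A (min k n)

/-- The cell algebras, shifted by one and continued by zero above `n`. -/
def towerF : ℕ → Type u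
  | 0 => PUnit
  | k + 1 => X.cellSub k

instance : ∀ k, NonUnitalCStarAlgebra (X.towerA k)
  | 0 => inferInstanceAs (NonUnitalCStarAlgebra PUnit)
  | k + 1 => inferInstanceAs (NonUnitalCStarAlgebra (X.A (min k n)))

instance : ∀ k, NonUnitalCStarAlgebra (X.towerF k)
  | 0 => inferInstanceAs (NonUnitalCStarAlgebra PUnit)
  | k + 1 => inferInstanceAs (NonUnitalCStarAlgebra (X.cellSub k))

instance : ∀ k, FiniteDimensional ℂ (X.towerF k)
  | 0 => inferInstanceAs (FiniteDimensional ℂ PUnit)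
  | k + 1 => inferInstanceAs (FiniteDimensional ℂ (X.cellSub k))

instance : Subsingleton (X.towerA 0) := inferInstanceAs (Subsingleton PUnit)

instance : Subsingleton (X.towerF 0) := inferInstanceAs (Subsingleton PUnit)

/-- The inclusion of the truncated cell algebra. -/
def cellVal (k : ℕ) : X.towerF (k + 1) →⋆ₙₐ[ℂ] X.F k :=
  NonUnitalStarSubalgebraClass.subtype (X.cellSub k)

theorem cellVal_injective (k : ℕ) : Function.Injective (X.cellVal k) := Subtype.val_injective

theorem towerF_subsingleton (k : ℕ) (hk : n < k) : Subsingleton (X.towerF (k + 1)) :=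
  X.cellSub_subsingleton k hk

/-- For `k ≤ n`, the truncated cell algebra is the whole cell algebra. -/
def toCell (k : ℕ) (hk : k ≤ n) : X.F k →⋆ₙₐ[ℂ] X.towerF (k + 1) :=
  NonUnitalStarAlgHom.codRestrict (NonUnitalStarAlgHom.id ℂ (X.F k)) (X.cellSub k)
    fun _ => Or.inl hk

theorem towerF_ext {Z : Type*} [TopologicalSpace Z] {k : ℕ} {f g : C(Z, X.towerF (k + 1))}
    (h : ∀ x, k ≤ n → X.cellVal k (f x) = X.cellVal k (g x)) : f = g := by
  ext x
  by_cases hk : k ≤ n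
  · exact X.cellVal_injective k (h x hk)
  · exact (X.towerF_subsingleton k (not_le.mp hk)).elim _ _

/-- For `k ≤ n`, the truncated skeleton algebra is the original one. -/
def toSkel (k : ℕ) (hk : k ≤ n) : X.towerA (k + 1) →⋆ₙₐ[ℂ] X.A k :=
  X.trans (min k n) k (le_min le_rfl hk) (min_le_right _ _)

theorem toSkel_bijective (k : ℕ) (hk : k ≤ n) : Function.Bijective (X.toSkel k hk) :=
  X.trans_bijective (min_eq_left hk) (min_le_right _ _)

/-- The projections of the truncated tower. -/
def towerπ : ∀ k, X.towerA (k + 1) →⋆ₙₐ[ℂ] X.towerA k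
  | 0 => 0
  | k + 1 => X.trans (min (k + 1) n) (min k n) (min_le_min_right n k.le_succ) (min_le_right _ _)

theorem towerπ_bijective (k : ℕ) (hk : n ≤ k) : Function.Bijective (X.towerπ (k + 1)) :=
  X.trans_bijective (by omega) (min_le_right _ _)

theorem π_toSkel (k : ℕ) (hk : k < n) (a : X.towerA (k + 2)) :
    X.π k hk (X.toSkel (k + 1) hk a) = X.toSkel k hk.le (X.towerπ (k + 1) a) :=
  (X.trans_succ k hk _).symm.trans ((X.trans_trans _ _ _ _ (min_le_right _ _) _ _).trans
    (X.trans_trans _ _ _ _ (min_le_right _ _) _ _).symm)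

open Classical in
/-- The maps to functions on cubes of the truncated tower. -/
def towerρ (k : ℕ) : X.towerA (k + 1) →⋆ₙₐ[ℂ] C(NCube k, X.towerF (k + 1)) :=
  if hk : k ≤ n then (mapHom (NCube k) (X.toCell k hk)).comp ((X.ρ k hk).comp (X.toSkel k hk))
  else 0

open Classical in
/-- The connecting morphisms of the truncated tower. -/
def towerσ : ∀ k, X.towerA k →⋆ₙₐ[ℂ] C(NSphere k, X.towerF (k + 1))
  | 0 => 0
  | k + 1 => if hk : k < n then
      (mapHom (NSphere (k + 1)) (X.toCell (k + 1) hk)).comp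
        ((X.σ k hk).comp (X.toSkel k hk.le))
    else 0

theorem cellVal_towerρ (k : ℕ) (hk : k ≤ n) (a : X.towerA (k + 1)) (x : NCube k) :
    X.cellVal k (X.towerρ k a x) = X.ρ k hk (X.toSkel k hk a) x := by
  rw [towerρ, dif_pos hk]; rfl

theorem cellVal_towerσ (k : ℕ) (hk : k < n) (a : X.towerA (k + 1)) (x : NSphere (k + 1)) :
    X.cellVal (k + 1) (X.towerσ (k + 1) a x) = X.σ k hk (X.toSkel k hk.le a) x := by
  rw [towerσ, dif_pos hk]; rfl

theorem ρ_zero_apply (a : X.A 0) (x : NCube 0) : X.ρ 0 n.zero_le a x = X.iso₀ a := rfl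

/-- The tower of skeleta of an NCCW complex. -/
def tower : CellTower.{u} where
  A := X.towerA
  F := X.towerF
  σ := X.towerσ
  ρ := X.towerρ
  π := X.towerπ
  boundary_ρ := by
    rintro (_ | k) a
    · exact ContinuousMap.ext isEmptyElim
    · refine X.towerF_ext fun x hk => ?_
      rw [boundaryMap_apply, cellVal_towerρ _ _ hk, cellVal_towerσ _ _ hk, ← π_toSkel, ← boundary_ρ]
      rfl
  ext := by
    rintro (_ | k) a b h1 h2
    · apply (X.toSkel_bijective 0 n.zero_le).injective
      have h := congrArg (fun f => X.cellVal 0 (f 0)) h1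
      simp only [cellVal_towerρ _ _ n.zero_le, ρ_zero_apply] at h
      exact X.iso₀.injective h
    · by_cases hk : k < n
      · apply (X.toSkel_bijective (k + 1) hk).injective
        apply X.ext_ρ_π k hk
        · ext x
          have h := congrArg (fun f => X.cellVal (k + 1) (f x)) h1
          simpa only [cellVal_towerρ _ _ hk] using h
        · rw [π_toSkel, π_toSkel, h2]
      -- Above dimension n no cells are attached, and the projection alone determines the element.
      · exact (X.towerπ_bijective k (not_lt.mp hk)).injective h2
  exists_of_boundary := by
    rintro (_ | k) f a h
    · obtain ⟨b, hb⟩ := EquivLike.surjective X.iso₀ (X.cellVal 0 (f 0))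
      obtain ⟨c, rfl⟩ := (X.toSkel_bijective 0 n.zero_le).surjective b
      refine ⟨c, X.towerF_ext fun x hk => ?_, Subsingleton.elim _ _⟩
      rw [cellVal_towerρ _ _ hk, ρ_zero_apply, hb, Subsingleton.elim x 0]
    · by_cases hk : k < n
      · obtain ⟨b, h1, h2⟩ := X.exists_of_boundary k hk (mapHom _ (X.cellVal (k + 1)) f)
          (X.toSkel k hk.le a) (by
            ext x
            rw [← cellVal_towerσ, ← h]
            rfl)
        obtain ⟨c, rfl⟩ := (X.toSkel_bijective (k + 1) hk).surjective b
        refine ⟨c, X.towerF_ext fun x _ => ?_, ?_⟩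
        · rw [cellVal_towerρ _ _ hk, h1, mapHom_apply]
        · apply (X.toSkel_bijective k hk.le).injective
          rw [← h2, π_toSkel]
      · obtain ⟨c, hc⟩ := (X.towerπ_bijective k (not_lt.mp hk)).surjective a
        exact ⟨c, X.towerF_ext fun x h => absurd h hk, hc⟩

/-- The projections from an NCCW complex to the skeleta of its tower. -/
def toTower : ∀ k, X.total →⋆ₙₐ[ℂ] X.tower.A k
  | 0 => 0
  | k + 1 => X.trans n (min k n) (min_le_right _ _) le_rfl

theorem π_toTower (k : ℕ) (a : X.total) :
    X.tower.π k (X.toTower (k + 1) a) = X.toTower k a := by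
  cases k with
  | zero => rfl
  | succ k => exact X.trans_trans _ _ _ _ le_rfl _ _

theorem toTower_bijective (k : ℕ) (hk : n < k) : Function.Bijective (X.toTower k) := by
  cases k with
  | zero => omega
  | succ k => exact X.trans_bijective (min_eq_right (by omega)).symm le_rfl

/-- Descends from the bijective level n + 1 along the surjective projections of the tower. -/
theorem toTower_surjective (k : ℕ) : Function.Surjective (X.toTower k) := by
  obtain hk | hk := lt_or_ge n k
  · exact (X.toTower_bijective k hk).surjective
  · replace hk : k ≤ n + 1 := by omega
    induction hk using Nat.decreasingInduction with
    | self => exact (X.toTower_bijective _ n.lt_succ_self).surjective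
    | of_succ k _ ih =>
      intro a
      obtain ⟨b, rfl⟩ := X.tower.π_surjective k a
      obtain ⟨c, rfl⟩ := ih b
      exact ⟨c, (X.π_toTower k c).symm⟩

/-- The index shift of the tower matches that of the canonical ideals: I_0 is everything because
level 0 is the zero algebra, and I_k vanishes for k > n because the tower has stabilised there. -/
theorem mem_ideal_iff (k : ℕ) (a : X.total) : a ∈ X.ideal k ↔ X.toTower k a = 0 := by
  rcases k with _ | k
  · exact iff_of_true trivial rfl
  · by_cases hk : k ≤ n
    · rw [ideal, dif_pos hk, TwoSidedIdeal.mem_ker, ← trans_eq_toSkeleton,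
        ← X.trans_trans n (min k n) k (min_le_right _ _) le_rfl (le_min le_rfl hk)]
      exact map_eq_zero_iff _ (X.trans_bijective (min_eq_left hk) (min_le_right _ _)).injective
    · rw [ideal, dif_neg hk, TwoSidedIdeal.mem_bot]
      exact (map_eq_zero_iff _ (X.toTower_bijective (k + 1) (by omega)).injective).symm

theorem tower_F_nontrivial (k : ℕ) (hk : k ≤ n) [Nontrivial (X.F k)] :
    Nontrivial (X.tower.F (k + 1)) :=
  (show Function.Injective (X.toCell k hk) from fun _ _ h => congrArg (X.cellVal k) h).nontrivial

end NCCWComplex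


/-! ### Functions on the cylinder over the cells -/

namespace CellTower

variable {T U : CellTower.{u}}

/-- The first coordinate is the cylinder parameter. The sphere splits into upper end, lower end and
side wall, the three pieces used for gluing. -/
theorem cons_mem_boundary {k : ℕ} (t : unitInterval) (y : NCube k) :
    (Fin.cons t y : NCube (k + 1)) ∈ Cube.boundary (Fin (k + 1)) ↔
      t = 1 ∨ t = 0 ∨ y ∈ Cube.boundary (Fin k) := by
  simp only [Cube.boundary, Set.mem_ofPred_eq, Fin.exists_fin_succ, Fin.cons_zero, Fin.cons_succ]
  rw [or_comm (a := t = 0), or_assoc]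

theorem continuous_tail (k : ℕ) :
    Continuous fun x : NCube (k + 1) => (Fin.tail x : NCube k) :=
  continuous_pi fun _ => continuous_apply _

/-- The functions `ρ (f t)`, as a function on `[0,1] × [0,1]^k = [0,1]^{k+1}`. -/
def cylρ (U : CellTower.{u}) (k : ℕ) :
    C(unitInterval, U.A (k + 1)) →⋆ₙₐ[ℂ] C(NCube (k + 1), U.F (k + 1)) where
  toFun f := ⟨fun x => U.ρ k (f (x 0)) (Fin.tail x), by
    have h := (starHom_continuous (U.ρ k)).comp f.continuous
    exact ContinuousEval.continuous_eval.comp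
      ((h.comp (continuous_apply (0 : Fin (k + 1)))).prodMk (continuous_tail k))⟩
  map_smul' _ _ := by ext; simp
  map_zero' := by ext; simp
  map_add' _ _ := by ext; simp
  map_mul' _ _ := by ext; simp
  map_star' _ := by ext; simp [map_star]

/-- Evaluation at a point, as a morphism. -/
def evalHom {Z A : Type*} [TopologicalSpace Z] [NonUnitalCStarAlgebra A] (z : Z) :
    C(Z, A) →⋆ₙₐ[ℂ] A where
  toFun f := f z
  map_smul' _ _ := rfl
  map_zero' := rfl
  map_add' _ _ := rfl
  map_mul' _ _ := rfl
  map_star' _ := rfl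

/-- The pair `(ρ, π)` as a morphism into the direct sum. -/
def ρπ (U : CellTower.{u}) (k : ℕ) : U.A (k + 1) →⋆ₙₐ[ℂ] C(NCube k, U.F (k + 1)) × U.A k :=
  (U.ρ k).prod (U.π k)

/-- An injective morphism is isometric, so continuity of a path in a skeleton can be tested on its
images under ρ and π. -/
theorem ρπ_isometry (U : CellTower.{u}) (k : ℕ) : Isometry (U.ρπ k) :=
  NonUnitalStarAlgHom.isometry _ fun a b h =>
    U.ext k a b (congrArg Prod.fst h) (congrArg Prod.snd h)

/-- A path in the skeleton `A k`, together with a compatible function on the cylinder over the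
`k`-cells, lifts to the next skeleton. -/
theorem exists_path_lift (U : CellTower.{u}) (k : ℕ) (h : C(NCube (k + 1), U.F (k + 1)))
    (f : C(unitInterval, U.A k))
    (hf : ∀ t (y : NSphere k), h (Fin.cons t y.1 : NCube (k + 1)) = U.σ k (f t) y) :
    ∃ g : C(unitInterval, U.A (k + 1)), U.cylρ k g = h ∧ ∀ t, U.π k (g t) = f t := by
  have hc : Continuous fun p : unitInterval × NCube k => (Fin.cons p.1 p.2 : NCube (k + 1)) := by
    refine continuous_pi fun i => ?_
    cases i using Fin.cases with
    | zero => exact continuous_fst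
    | succ i => exact (continuous_apply i).comp continuous_snd
  let H : C(unitInterval, C(NCube k, U.F (k + 1))) := ContinuousMap.curry (h.comp ⟨_, hc⟩)
  have hH (t) (y : NCube k) : H t y = h (Fin.cons t y : NCube (k + 1)) := rfl
  choose g hg1 hg2 using fun t => U.exists_of_boundary k (H t) (f t) (by
    ext y; rw [boundaryMap_apply, hH, hf])
  refine ⟨⟨g, ?_⟩, ?_, hg2⟩
  -- The lift was chosen pointwise; its continuity follows from that of its two coordinates.
  · refine (U.ρπ_isometry k).isEmbedding.continuous_iff.mpr ?_
    have : U.ρπ k ∘ g = fun t => (H t, f t) := funext fun t => Prod.ext (hg1 t) (hg2 t)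
    rw [this]
    exact H.continuous.prodMk f.continuous
  · ext x
    change U.ρ k (g (x 0)) (Fin.tail x) = h x
    rw [hg1, hH, Fin.cons_self_tail]

theorem eval_ρ_zero_injective (T : CellTower.{u}) {a b : T.A 1}
    (h : T.ρ 0 a 0 = T.ρ 0 b 0) : a = b :=
  T.ext 0 a b (ContinuousMap.ext fun x => by rwa [Subsingleton.elim x 0]) (Subsingleton.elim _ _)

theorem eval_ρ_zero_surjective (T : CellTower.{u}) (c : T.F 1) :
    ∃ a, T.ρ 0 a 0 = c := by
  obtain ⟨a, ha, -⟩ := T.exists_of_boundary 0 (ContinuousMap.const _ c) 0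
    (ContinuousMap.ext isEmptyElim)
  exact ⟨a, by rw [ha]; rfl⟩

/-! ### Skeleta of the mapping cylinder and the gluing map -/

/-- A morphism of towers. -/
structure Hom (T U : CellTower.{u}) where
  /-- the morphisms between the skeleton algebras -/
  app : ∀ k, T.A k →⋆ₙₐ[ℂ] U.A k
  π_app : ∀ k a, U.π k (app (k + 1) a) = app k (T.π k a)

namespace Hom

variable (α : Hom T U)

/-- The `k`-skeleton of the mapping cylinder of a morphism of towers. -/
def cylSkel (k : ℕ) :
    NonUnitalStarSubalgebra ℂ (T.A (k + 1) × C(unitInterval, U.A k) × U.A (k + 1)) where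
  carrier := {p | p.2.1 1 = α.app k (T.π k p.1) ∧ p.2.1 0 = U.π k p.2.2}
  add_mem' := by rintro p q ⟨hp, hp'⟩ ⟨hq, hq'⟩; simp [*]
  zero_mem' := by simp
  mul_mem' := by rintro p q ⟨hp, hp'⟩ ⟨hq, hq'⟩; simp [*]
  smul_mem' := by rintro c p ⟨hp, hp'⟩; simp [*]
  star_mem' := by rintro p ⟨hp, hp'⟩; simp [*, map_star]

theorem isClosed_cylSkel (k : ℕ) :
    IsClosed (α.cylSkel k : Set (T.A (k + 1) × C(unitInterval, U.A k) × U.A (k + 1))) := by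
  have h (t : unitInterval) : Continuous
      fun p : T.A (k + 1) × C(unitInterval, U.A k) × U.A (k + 1) => p.2.1 t :=
    (continuous_eval_const (F := C(unitInterval, U.A k)) t).comp
      (continuous_fst.comp continuous_snd)
  exact (isClosed_eq (h 1) (((starHom_continuous (α.app k)).comp
    (starHom_continuous (T.π k))).comp continuous_fst)).inter
    (isClosed_eq (h 0) ((starHom_continuous (U.π k)).comp (continuous_snd.comp continuous_snd)))

instance (k : ℕ) : NonUnitalCStarAlgebra (α.cylSkel k) :=
  NonUnitalStarSubalgebra.nonUnitalCStarAlgebra _ (h_closed := α.isClosed_cylSkel k)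

open Classical in
/-- The value at a point of the boundary of `[0,1] × [0,1]^k` of the function given by an element
of the skeleton. -/
def glueFun (k : ℕ) (x : NCube (k + 1)) :
    T.A (k + 1) × C(unitInterval, U.A k) × U.A (k + 1) →⋆ₙₐ[ℂ] U.F (k + 1) :=
  -- For each fixed x this is a morphism on the whole direct sum, so the algebraic laws of `glue`
  -- hold pointwise; the end conditions are needed only for continuity.
  if x 0 = 1 then
    ((evalHom (Fin.tail x)).comp ((U.ρ k).comp (α.app (k + 1)))).comp (NonUnitalStarAlgHom.fst ℂ _ _)
  else if x 0 = 0 then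
    ((evalHom (Fin.tail x)).comp (U.ρ k)).comp
      ((NonUnitalStarAlgHom.snd ℂ _ _).comp (NonUnitalStarAlgHom.snd ℂ _ _))
  else if h : (Fin.tail x : NCube k) ∈ Cube.boundary (Fin k) then
    ((evalHom ⟨_, h⟩).comp ((U.σ k).comp (evalHom (x 0)))).comp
      ((NonUnitalStarAlgHom.fst ℂ _ _).comp (NonUnitalStarAlgHom.snd ℂ _ _))
  -- Junk value at interior points of the cube, where the function is never evaluated.
  else 0

variable {α}

theorem glueFun_one {k : ℕ} (p : T.A (k + 1) × C(unitInterval, U.A k) × U.A (k + 1))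
    {x : NCube (k + 1)} (hx : x 0 = 1) :
    α.glueFun k x p = U.ρ k (α.app (k + 1) p.1) (Fin.tail x) := by
  rw [glueFun, if_pos hx]; rfl

theorem glueFun_zero {k : ℕ} (p : T.A (k + 1) × C(unitInterval, U.A k) × U.A (k + 1))
    {x : NCube (k + 1)} (hx : x 0 = 0) :
    α.glueFun k x p = U.ρ k p.2.2 (Fin.tail x) := by
  rw [glueFun, if_neg (by rw [hx]; exact zero_ne_one), if_pos hx]; rfl

/-- The wall formula persists on the edges where the wall meets the two ends: there the end
conditions on the triple turn σ(f(t)) into the boundary value of the function prescribed on the end.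
-/
theorem glueFun_boundary {k : ℕ} {p : T.A (k + 1) × C(unitInterval, U.A k) × U.A (k + 1)}
    (hp : p ∈ α.cylSkel k) {x : NCube (k + 1)}
    (hx : (Fin.tail x : NCube k) ∈ Cube.boundary (Fin k)) :
    α.glueFun k x p = U.σ k (p.2.1 (x 0)) ⟨_, hx⟩ := by
  by_cases h1 : x 0 = 1
  · rw [glueFun_one p h1, h1, hp.1, ← α.π_app, ← U.boundary_ρ]
    rfl
  by_cases h0 : x 0 = 0
  · rw [glueFun_zero p h0, h0, hp.2, ← U.boundary_ρ]
    rfl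
  rw [glueFun, if_neg h1, if_neg h0, dif_pos hx]; rfl

/-- Pasting over three closed pieces, on each of which a single continuous formula is valid. -/
theorem continuousOn_glueFun {k : ℕ} {p : T.A (k + 1) × C(unitInterval, U.A k) × U.A (k + 1)}
    (hp : p ∈ α.cylSkel k) :
    ContinuousOn (fun x => α.glueFun k x p) (Cube.boundary (Fin (k + 1))) := by
  have hS : Cube.boundary (Fin (k + 1)) ⊆ {x : NCube (k + 1) | x 0 = 1} ∪
      ({x : NCube (k + 1) | x 0 = 0} ∪
        {x : NCube (k + 1) | (Fin.tail x : NCube k) ∈ Cube.boundary (Fin k)}) := by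
    intro x hx
    rw [← Fin.cons_self_tail x] at hx
    exact (cons_mem_boundary _ _).mp hx
  have e (t : unitInterval) : IsClosed {x : NCube (k + 1) | x 0 = t} :=
    isClosed_eq (continuous_apply 0) continuous_const
  have e2 : IsClosed {x : NCube (k + 1) | (Fin.tail x : NCube k) ∈ Cube.boundary (Fin k)} :=
    (Cube.isClosed_boundary k).preimage (continuous_tail k)
  refine ContinuousOn.mono (ContinuousOn.union_of_isClosed ?_
    (ContinuousOn.union_of_isClosed ?_ ?_ (e 0) e2) (e 1) ((e 0).union e2)) hS
  · exact (((U.ρ k (α.app (k + 1) p.1)).continuous.comp (continuous_tail k)).continuousOn).congr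
      fun x hx => glueFun_one p hx
  · exact (((U.ρ k p.2.2).continuous.comp (continuous_tail k)).continuousOn).congr
      fun x hx => glueFun_zero p hx
  · rw [continuousOn_iff_continuous_domRestrict]
    have h : Continuous fun x : {x : NCube (k + 1) |
        (Fin.tail x : NCube k) ∈ Cube.boundary (Fin k)} =>
        U.σ k (p.2.1 (x.1 0)) ⟨Fin.tail x.1, x.2⟩ :=
      ContinuousEval.continuous_eval.comp
        ((((starHom_continuous (U.σ k)).comp p.2.1.continuous).comp
          ((continuous_apply (0 : Fin (k + 1))).comp continuous_subtype_val)).prodMk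
          (((continuous_tail k).comp continuous_subtype_val).subtype_mk fun x => x.2))
    exact h.congr fun x => (glueFun_boundary hp x.2).symm

variable (α)

/-- The connecting morphism for the cells of the mapping cylinder lying over the interval. -/
def glue (k : ℕ) : α.cylSkel k →⋆ₙₐ[ℂ] C(NSphere (k + 1), U.F (k + 1)) where
  toFun p := ⟨fun x => α.glueFun k x.1 p.1,
    continuousOn_iff_continuous_domRestrict.mp (continuousOn_glueFun p.2)⟩
  map_smul' c p := ContinuousMap.ext fun x => map_smul (α.glueFun k x.1) c p.1
  map_zero' := ContinuousMap.ext fun x => map_zero (α.glueFun k x.1)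
  map_add' p q := ContinuousMap.ext fun x => map_add (α.glueFun k x.1) p.1 q.1
  map_mul' p q := ContinuousMap.ext fun x => map_mul (α.glueFun k x.1) p.1 q.1
  map_star' p := ContinuousMap.ext fun x => map_star (α.glueFun k x.1) p.1

/-- The pair of morphisms into function algebras, as a morphism into functions with values in the
direct sum. -/
def pairHom {Z A B C : Type*} [TopologicalSpace Z] [NonUnitalCStarAlgebra A]
    [NonUnitalCStarAlgebra B] [NonUnitalCStarAlgebra C] (f : A →⋆ₙₐ[ℂ] C(Z, B))
    (g : A →⋆ₙₐ[ℂ] C(Z, C)) : A →⋆ₙₐ[ℂ] C(Z, B × C) where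
  toFun a := (f a).prodMk (g a)
  map_smul' _ _ := by ext <;> simp
  map_zero' := by ext <;> simp
  map_add' _ _ := by ext <;> simp
  map_mul' _ _ := by ext <;> simp
  map_star' _ := by ext <;> simp [map_star]

/-- The projection of the skeleton of the cylinder to the upper end. -/
def cylFst (k : ℕ) : α.cylSkel k →⋆ₙₐ[ℂ] T.A (k + 1) :=
  (NonUnitalStarAlgHom.fst ℂ _ _).comp (NonUnitalStarSubalgebraClass.subtype (α.cylSkel k))

/-- The projection of the skeleton of the cylinder to the interior. -/
def cylMid (k : ℕ) : α.cylSkel k →⋆ₙₐ[ℂ] C(unitInterval, U.A k) :=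
  ((NonUnitalStarAlgHom.fst ℂ _ _).comp (NonUnitalStarAlgHom.snd ℂ _ _)).comp
    (NonUnitalStarSubalgebraClass.subtype (α.cylSkel k))

/-- The projection of the skeleton of the cylinder to the lower end. -/
def cylSnd (k : ℕ) : α.cylSkel k →⋆ₙₐ[ℂ] U.A (k + 1) :=
  ((NonUnitalStarAlgHom.snd ℂ _ _).comp (NonUnitalStarAlgHom.snd ℂ _ _)).comp
    (NonUnitalStarSubalgebraClass.subtype (α.cylSkel k))

theorem cylMid_one {k : ℕ} (p : α.cylSkel k) :
    α.cylMid k p 1 = α.app k (T.π k (α.cylFst k p)) := p.2.1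

theorem cylMid_zero {k : ℕ} (p : α.cylSkel k) : α.cylMid k p 0 = U.π k (α.cylSnd k p) := p.2.2

variable {α} in
theorem cylSkel_ext {k : ℕ} {p q : α.cylSkel k} (h1 : α.cylFst k p = α.cylFst k q)
    (h2 : α.cylMid k p = α.cylMid k q) (h3 : α.cylSnd k p = α.cylSnd k q) : p = q :=
  Subtype.ext (Prod.ext h1 (Prod.ext h2 h3))

/-! ### The skeleta of the cylinder as pullbacks -/

/-- The connecting morphisms of the mapping cylinder. -/
def cylσ (k : ℕ) :
    α.cylSkel k →⋆ₙₐ[ℂ] C(NSphere (k + 1), T.F (k + 2) × U.F (k + 2) × U.F (k + 1)) :=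
  pairHom ((T.σ (k + 1)).comp (α.cylFst k))
    (pairHom ((U.σ (k + 1)).comp (α.cylSnd k)) (α.glue k))

/-- The projections between the skeleta of the mapping cylinder. -/
def cylπ (k : ℕ) : α.cylSkel (k + 1) →⋆ₙₐ[ℂ] α.cylSkel k :=
  NonUnitalStarAlgHom.codRestrict
    (((T.π (k + 1)).comp (α.cylFst (k + 1))).prod
      (((mapHom unitInterval (U.π k)).comp (α.cylMid (k + 1))).prod
        ((U.π (k + 1)).comp (α.cylSnd (k + 1))))) (α.cylSkel k) fun p => by
    refine ⟨?_, ?_⟩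
    · change U.π k (α.cylMid (k + 1) p 1) = α.app k (T.π k (T.π (k + 1) (α.cylFst (k + 1) p)))
      rw [cylMid_one, α.π_app]
    · change U.π k (α.cylMid (k + 1) p 0) = U.π k (U.π (k + 1) (α.cylSnd (k + 1) p))
      rw [cylMid_zero]

/-- The maps of the skeleta of the mapping cylinder to functions on cubes. -/
def cylCell (k : ℕ) :
    α.cylSkel (k + 1) →⋆ₙₐ[ℂ] C(NCube (k + 1), T.F (k + 2) × U.F (k + 2) × U.F (k + 1)) :=
  pairHom ((T.ρ (k + 1)).comp (α.cylFst (k + 1)))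
    (pairHom ((U.ρ (k + 1)).comp (α.cylSnd (k + 1))) ((U.cylρ k).comp (α.cylMid (k + 1))))

theorem boundary_cylCell (k : ℕ) (p : α.cylSkel (k + 1)) :
    boundaryMap (k + 1) (T.F (k + 2) × U.F (k + 2) × U.F (k + 1)) (α.cylCell k p) =
      α.cylσ k (α.cylπ k p) := by
  ext x : 1
  refine Prod.ext ?_ (Prod.ext ?_ ?_)
  · exact congrArg (fun f => f x) (T.boundary_ρ (k + 1) (α.cylFst (k + 1) p))
  · exact congrArg (fun f => f x) (U.boundary_ρ (k + 1) (α.cylSnd (k + 1) p))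
  · change U.ρ k (α.cylMid (k + 1) p (x.1 0)) (Fin.tail x.1) = α.glueFun k x.1 (α.cylπ k p).1
    have hx := x.2
    rw [← Fin.cons_self_tail x.1, cons_mem_boundary] at hx
    obtain h | h | h := hx
    · rw [glueFun_one _ h, h, cylMid_one]
      rfl
    · rw [glueFun_zero _ h, h, cylMid_zero]
      rfl
    · rw [glueFun_boundary (α.cylπ k p).2 h]
      exact congrArg (fun f => f ⟨_, h⟩) (U.boundary_ρ k (α.cylMid (k + 1) p (x.1 0)))

/-- The morphism from a skeleton of the mapping cylinder to the pullback. -/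
def cylToPullback (k : ℕ) : α.cylSkel (k + 1) →⋆ₙₐ[ℂ]
    StarPullback (boundaryMap (k + 1) (T.F (k + 2) × U.F (k + 2) × U.F (k + 1))) (α.cylσ k) where
  toFun p := ⟨(α.cylCell k p, α.cylπ k p), α.boundary_cylCell k p⟩
  map_smul' c p := Subtype.ext (Prod.ext (map_smul (α.cylCell k) c p) (map_smul (α.cylπ k) c p))
  map_zero' := Subtype.ext (Prod.ext (map_zero (α.cylCell k)) (map_zero (α.cylπ k)))
  map_add' p q := Subtype.ext (Prod.ext (map_add (α.cylCell k) p q) (map_add (α.cylπ k) p q))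
  map_mul' p q := Subtype.ext (Prod.ext (map_mul (α.cylCell k) p q) (map_mul (α.cylπ k) p q))
  map_star' p := Subtype.ext (Prod.ext (map_star (α.cylCell k) p) (map_star (α.cylπ k) p))

/-- Each coordinate of a triple is determined by its images under ρ and π; for the path this is
applied at every time t. -/
theorem cylToPullback_injective (k : ℕ) : Function.Injective (α.cylToPullback k) := by
  intro p q h
  have h1 : α.cylCell k p = α.cylCell k q := congrArg (fun z => z.1.1) h
  have h2 : α.cylπ k p = α.cylπ k q := congrArg (fun z => z.1.2) h
  have c1 (x) := congrArg (fun f => (f x).1) h1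
  have c2 (x) := congrArg (fun f => (f x).2.1) h1
  have c3 (x) := congrArg (fun f => (f x).2.2) h1
  refine cylSkel_ext ?_ (ContinuousMap.ext fun t => ?_) ?_
  · exact T.ext _ _ _ (ContinuousMap.ext c1) (congrArg (α.cylFst k) h2)
  · refine U.ext _ _ _ (ContinuousMap.ext fun y => ?_) (congrArg (fun z => α.cylMid k z t) h2)
    exact c3 (Fin.cons t y)
  · exact U.ext _ _ _ (ContinuousMap.ext c2) (congrArg (α.cylSnd k) h2)

/-- The three coordinates are lifted independently. The end conditions then hold automatically: they
are equalities in a skeleton of U, whose ρ-parts are read off from h on the faces t = 1 and t = 0,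
and whose π-parts are the end conditions of p. -/
theorem exists_of_boundary (k : ℕ) (h : C(NCube (k + 1), T.F (k + 2) × U.F (k + 2) × U.F (k + 1)))
    (p : α.cylSkel k) (hx : ∀ x : NSphere (k + 1), h x.1 = α.cylσ k p x) :
    ∃ q, α.cylCell k q = h ∧ α.cylπ k q = p := by
  obtain ⟨a, ha1, ha2⟩ := T.exists_of_boundary (k + 1) (ContinuousMap.fst.comp h)
    (α.cylFst k p) (ContinuousMap.ext fun x => congrArg Prod.fst (hx x))
  obtain ⟨b, hb1, hb2⟩ := U.exists_of_boundary (k + 1)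
    (ContinuousMap.fst.comp (ContinuousMap.snd.comp h))
    (α.cylSnd k p) (ContinuousMap.ext fun x => congrArg (fun z => z.2.1) (hx x))
  have h3 (x : NSphere (k + 1)) : (h x.1).2.2 = α.glueFun k x.1 p.1 :=
    congrArg (fun z => z.2.2) (hx x)
  obtain ⟨f, hf1, hf2⟩ := U.exists_path_lift k (ContinuousMap.snd.comp (ContinuousMap.snd.comp h))
    (α.cylMid k p) (fun t y =>
      (h3 ⟨_, (cons_mem_boundary t y.1).mpr (Or.inr (Or.inr y.2))⟩).trans
        (glueFun_boundary p.2 (x := Fin.cons t y.1) y.2))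
  have hf1' (t) (y : NCube k) : U.ρ k (f t) y = (h (Fin.cons t y : NCube (k + 1))).2.2 :=
    congrArg (fun g => g (Fin.cons t y)) hf1
  have hm : (a, f, b) ∈ α.cylSkel (k + 1) := by
    refine ⟨U.ext k _ _ (ContinuousMap.ext fun y => ?_) ?_,
      U.ext k _ _ (ContinuousMap.ext fun y => ?_) ?_⟩
    · rw [hf1', h3 ⟨_, (cons_mem_boundary 1 y).mpr (Or.inl rfl)⟩, glueFun_one _ rfl, ha2]
      rfl
    · rw [hf2, cylMid_one, α.π_app, ha2]
    · rw [hf1', h3 ⟨_, (cons_mem_boundary 0 y).mpr (Or.inr (Or.inl rfl))⟩, glueFun_zero _ rfl, hb2]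
      rfl
    · rw [hf2, cylMid_zero, hb2]
  refine ⟨⟨(a, f, b), hm⟩, ContinuousMap.ext fun x => ?_, ?_⟩
  · exact Prod.ext (congrArg (fun g => g x) ha1)
      (Prod.ext (congrArg (fun g => g x) hb1) (congrArg (fun g => g x) hf1))
  · exact cylSkel_ext ha2 (ContinuousMap.ext hf2) hb2

theorem cylToPullback_surjective (k : ℕ) : Function.Surjective (α.cylToPullback k) := by
  rintro ⟨⟨h, p⟩, hp⟩
  obtain ⟨q, hq1, hq2⟩ := α.exists_of_boundary k h p fun x => congrArg (fun f => f x) hp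
  exact ⟨q, Subtype.ext (Prod.ext hq1 hq2)⟩

/-- The morphism from the bottom skeleton of the mapping cylinder to its cell algebra. -/
def cylBase : α.cylSkel 0 →⋆ₙₐ[ℂ] T.F 1 × U.F 1 × U.F 0 :=
  (((evalHom 0).comp (T.ρ 0)).comp (α.cylFst 0)).prod
    ((((evalHom 0).comp (U.ρ 0)).comp (α.cylSnd 0)).prod 0)

/-- In dimension zero the path takes values in the zero algebra, and what remains is the two
algebras of 0-cells. -/
theorem cylBase_bijective : Function.Bijective α.cylBase := by
  constructor
  · intro p q h
    exact cylSkel_ext (T.eval_ρ_zero_injective (congrArg Prod.fst h))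
      (ContinuousMap.ext fun t => Subsingleton.elim _ _)
      (U.eval_ρ_zero_injective (congrArg (fun z => z.2.1) h))
  · rintro ⟨c, d, e⟩
    obtain ⟨a, ha⟩ := T.eval_ρ_zero_surjective c
    obtain ⟨b, hb⟩ := U.eval_ρ_zero_surjective d
    exact ⟨⟨(a, 0, b), Subsingleton.elim _ _, Subsingleton.elim _ _⟩,
      Prod.ext ha (Prod.ext hb (Subsingleton.elim _ _))⟩

/-- The mapping cylinder of a morphism of towers, truncated in dimension `N`. -/
def cylComplex (N : ℕ) (hN : Nontrivial (T.F (N + 1) × U.F (N + 1) × U.F N)) :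
    NCCWComplex.{u} N where
  A k := α.cylSkel k
  F k := T.F (k + 1) × U.F (k + 1) × U.F k
  iso₀ := StarAlgEquiv.ofBijective α.cylBase α.cylBase_bijective
  σ k _ := α.cylσ k
  iso k _ := StarAlgEquiv.ofBijective (α.cylToPullback k)
    ⟨α.cylToPullback_injective k, α.cylToPullback_surjective k⟩
  top_nontrivial _ := hN

end Hom

end CellTower


/-! ### From a morphism respecting the ideals to a morphism of towers -/

/-- A morphism vanishing on the kernel of a surjective morphism factors through it. -/
def liftOfSurjective {A B C : Type*} [NonUnitalCStarAlgebra A] [NonUnitalCStarAlgebra B]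
    [NonUnitalCStarAlgebra C] (q : A →⋆ₙₐ[ℂ] B) (hq : Function.Surjective q) (f : A →⋆ₙₐ[ℂ] C)
    (hf : ∀ a, q a = 0 → f a = 0) : B →⋆ₙₐ[ℂ] C :=
  -- Independence of the chosen preimage; each algebraic law follows by picking a convenient one.
  have key : ∀ {a b}, q a = b → f (Function.surjInv hq b) = f a := fun {a b} h => by
    rw [← sub_eq_zero, ← map_sub]
    exact hf _ (by rw [map_sub, Function.surjInv_eq hq, h, sub_self])
  { toFun b := f (Function.surjInv hq b)
    map_smul' c b := by
      rw [key (a := c • Function.surjInv hq b) (by rw [map_smul, Function.surjInv_eq hq]), map_smul]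
      rfl
    map_zero' := by rw [key (map_zero q), map_zero]
    map_add' b c := by
      rw [key (a := Function.surjInv hq b + Function.surjInv hq c)
        (by simp only [map_add, Function.surjInv_eq]), map_add]
    map_mul' b c := by
      rw [key (a := Function.surjInv hq b * Function.surjInv hq c)
        (by simp only [map_mul, Function.surjInv_eq]), map_mul]
    map_star' b := by
      rw [key (a := star (Function.surjInv hq b))
        (by simp only [map_star, Function.surjInv_eq]), map_star] }

theorem liftOfSurjective_apply {A B C : Type*} [NonUnitalCStarAlgebra A]
    [NonUnitalCStarAlgebra B] [NonUnitalCStarAlgebra C] (q : A →⋆ₙₐ[ℂ] B)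
    (hq : Function.Surjective q) (f : A →⋆ₙₐ[ℂ] C) (hf : ∀ a, q a = 0 → f a = 0) (a : A) :
    liftOfSurjective q hq f hf (q a) = f a := by
  change f (Function.surjInv hq (q a)) = f a
  rw [← sub_eq_zero, ← map_sub]
  exact hf _ (by rw [map_sub, Function.surjInv_eq hq, sub_self])

namespace NCCWComplex

variable {n m : ℕ} {X : NCCWComplex.{u} n} {Y : NCCWComplex.{u} m}

section

variable (α : X.total →⋆ₙₐ[ℂ] Y.total) (hα : ∀ k, ∀ a ∈ X.ideal k, α a ∈ Y.ideal k)

/-- A morphism respecting the canonical ideals induces morphisms between the skeleta. -/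
def towerMap (k : ℕ) : X.tower.A k →⋆ₙₐ[ℂ] Y.tower.A k :=
  liftOfSurjective (X.toTower k) (X.toTower_surjective k) ((Y.toTower k).comp α) fun a ha =>
    (Y.mem_ideal_iff k (α a)).mp (hα k a ((X.mem_ideal_iff k a).mpr ha))

theorem towerMap_toTower (k : ℕ) (a : X.total) :
    towerMap α hα k (X.toTower k a) = Y.toTower k (α a) :=
  liftOfSurjective_apply _ _ _ _ a

/-- The morphism of towers induced by a morphism respecting the canonical ideals. -/
def towerHom : CellTower.Hom X.tower Y.tower where
  app := towerMap α hα
  π_app k a := by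
    obtain ⟨b, rfl⟩ := X.toTower_surjective (k + 1) a
    rw [towerMap_toTower, π_toTower, π_toTower, towerMap_toTower]

theorem towerHom_toTower (k : ℕ) (a : X.total) :
    (towerHom α hα).app k (X.toTower k a) = Y.toTower k (α a) :=
  towerMap_toTower α hα k a

/-! ### Comparison with the mapping cylinder -/

/-- The morphism from the mapping cylinder to the skeleta of the cylinder of the towers. -/
def cylToSkel (k : ℕ) : Cyl α →⋆ₙₐ[ℂ] (towerHom α hα).cylSkel k :=
  NonUnitalStarAlgHom.codRestrict
    ((((X.toTower (k + 1)).comp (NonUnitalStarAlgHom.fst ℂ _ _)).prod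
      (((mapHom unitInterval (Y.toTower k)).comp (NonUnitalStarAlgHom.snd ℂ _ _)).prod
        (((Y.toTower (k + 1)).comp (CellTower.evalHom 0)).comp
          (NonUnitalStarAlgHom.snd ℂ _ _)))).comp (NonUnitalStarSubalgebraClass.subtype (Cyl α)))
    _ fun p => by
      refine ⟨?_, (Y.π_toTower k _).symm⟩
      change Y.toTower k (p.1.2 1) =
        (towerHom α hα).app k (X.tower.π k (X.toTower (k + 1) p.1.1))
      rw [π_toTower, towerHom_toTower]
      exact congrArg _ p.2

/-- At these levels the towers have reached A_n and B_m. The bound on m is strict because the path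
lives one level below the ends; the projection between those levels is then bijective, so the lower
end b carries no information beyond f(0). -/
theorem cylToSkel_bijective (k : ℕ) (hn : n ≤ k) (hm : m < k) :
    Function.Bijective (cylToSkel α hα k) := by
  have hX := X.toTower_bijective (k + 1) (by omega)
  have hY := Y.toTower_bijective k hm
  have hY' := Y.toTower_bijective (k + 1) (by omega)
  constructor
  · intro p q h
    refine Subtype.ext (Prod.ext (hX.injective (congrArg (fun z => z.1.1) h))
      (ContinuousMap.ext fun t => hY.injective ?_))
    exact congrArg (fun z => z.1.2.1 t) h
  · rintro ⟨⟨a', f', b'⟩, h1, h2⟩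
    obtain ⟨a, rfl⟩ := hX.surjective a'
    obtain ⟨b, rfl⟩ := hY'.surjective b'
    choose f hf using fun t => hY.surjective (f' t)
    have hfc : Continuous f := by
      refine (NonUnitalStarAlgHom.isometry _ hY.injective).isEmbedding.continuous_iff.mpr ?_
      exact f'.continuous.congr fun t => (hf t).symm
    refine ⟨⟨(a, ⟨f, hfc⟩), hY.injective ?_⟩, ?_⟩
    · exact (hf 1).trans (h1.trans (by rw [π_toTower, towerHom_toTower]))
    · refine CellTower.Hom.cylSkel_ext rfl (ContinuousMap.ext hf) (congrArg (Y.toTower (k + 1)) ?_)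
      exact hY.injective ((hf 0).trans (h2.trans (Y.π_toTower k b)))

end

/-- If n ≥ m + 1 the top cells of A_n survive. Otherwise the top dimension is m + 1 and its product
cells carry G_m; this is nonzero by definition for m ≥ 1, while m = 0 forces n = 0, the case covered
by `hY`. -/
theorem nontrivial_cells (hY : n = 0 → Nontrivial Y.total) :
    Nontrivial (X.tower.F (max n (m + 1) + 1) × Y.tower.F (max n (m + 1) + 1) ×
      Y.tower.F (max n (m + 1))) := by
  obtain h | h := le_or_gt (m + 1) n
  · rw [max_eq_left h]
    have := X.top_nontrivial (by omega)
    have := X.tower_F_nontrivial n le_rfl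
    infer_instance
  · rw [max_eq_right h.le]
    have : Nontrivial (Y.F m) := by
      rcases m with _ | m
      · have := hY (by omega)
        exact Y.iso₀.symm.surjective.nontrivial
      · exact Y.top_nontrivial (by omega)
    have := Y.tower_F_nontrivial m le_rfl
    infer_instance

end NCCWComplex

end

theorem mainTheorem5 {n m : ℕ} (X : NCCWComplex.{u} n) (Y : NCCWComplex.{u} m)
    (hY : n = 0 → Nontrivial Y.total)
    (α : X.total →⋆ₙₐ[ℂ] Y.total) (hα : IsSimplicial X Y α) :
    IsNCCWOfDim (max n (m + 1)) (Cyl α) :=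
  ⟨(NCCWComplex.towerHom α hα.map_ideal).cylComplex _ (NCCWComplex.nontrivial_cells hY),
    ⟨StarAlgEquiv.ofBijective (NCCWComplex.cylToSkel α hα.map_ideal (max n (m + 1)))
      (NCCWComplex.cylToSkel_bijective α hα.map_ideal _ (le_max_left _ _)
        (Nat.lt_of_succ_le (le_max_right _ _)))⟩⟩
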